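/- Let $(\Omega,\mathcal F,\mathbb P)$ be an atomless probability space and let $\mathcal X=L^+$ be the set of nonnegative essentially bounded random variables on it; almost surely equal random variables are identified. For an increasing $h:[0,1]\to[0,1]$ with $h(0)=0$, $h(1)=1$ let $$\rho_h(X)=\int_0^\infty h(\mathbb P(X\ge x))\,dx+\int_{-\infty}^0\big(h(\mathbb P(X\ge x))-h(1)\big)\,dx .$$ For $n\ge 1$ and $X\in L^+$ let $\mathbb A_n(X)$ be the set of $(X_1,\dots,X_n)\in (L^+)^n$ with $\sum_i X_i=X$, and let $\mathbb A_n^-(X)$ be the set of those allocations that are pairwise counter-monotonic, i.e. $(X_i(\omega)-X_i(\omega'))(X_j(\omega)-X_j(\omega'))\le 0$ for $\mathbb P\times\mathbb P$-almost all $(\omega,\omega')$ and all $i\ne j$. Let $\square_{i=1}^n\rho_{h_i}(X)$ and $\boxminus_{i=1}^n\rho_{h_i}(X)$ be the infima of $\sum_i\rho_{h_i}(X_i)$ over $\mathbb A_n(X)$ and over $\mathbb A_n^-(X)$, respectively; an allocation is optimal in $\mathbb A_n(X)$ (in $\mathbb A_n^-(X)$) if it belongs to that set and attains the corresponding infimum.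 Let $\Pi_n$ be the set of $(A_1,\dots,A_n)\in\mathcal F^n$ that are pairwise disjoint with union $\Omega$, and let $$\square_{i=1}^n h_i(1)=\inf\Big\{\sum_{i=1}^n h_i(x_i): x_i\in[0,1],\ \sum_{i=1}^n x_i=1\Big\}.$$ Let $\alpha_1,\dots,\alpha_n\in(1,\infty)$, let $h_i(x)=x^{\alpha_i}$ for $x\in[0,1]$, and let $X=1$. (i) We have $\square_{i=1}^n\rho_{h_i}(X)=\boxminus_{i=1}^n\rho_{h_i}(X)=\square_{i=1}^n h_i(1)$. There exists $(A_1,\dots,A_n)\in\Pi_n$ with $\sum_{i=1}^n h_i(\mathbb P(A_i))=\square_{i=1}^n h_i(1)$, and the optimal allocations of $X$ in $\mathbb A_n(X)$, as well as those in $\mathbb A_n^-(X)$, are exactly the allocations $X_i=\mathbb 1_{A_i}$, $i=1,\dots,n$, with such $(A_1,\dots,A_n)$. (ii) Let $n\ge 3$, let $(A_1,\dots,A_n)\in\Pi_n$ satisfy $\sum_{i=1}^n h_i(\mathbb P(A_i))=\square_{i=1}^n h_i(1)$, and let $\alpha_1\le\dots\le\alpha_n$. Then $\mathbb P(A_1)\le\dots\le\mathbb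 P(A_n)$. -/

import Mathlib

open MeasureTheory

noncomputable section

namespace RiskSharing

variable {Ω : Type*} [MeasurableSpace Ω]

/-- An atomless measure: every measurable set of positive measure has a measurable subset of
strictly smaller positive measure. (Mathlib's `NoAtoms` only says that singletons are null.) -/
def Atomless (P : Measure Ω) : Prop :=
  ∀ A : Set Ω, MeasurableSet A → 0 < P A → ∃ B ⊆ A, MeasurableSet B ∧ 0 < P B ∧ P B < P A

/-- `L⁺`: the nonnegative essentially bounded random variables. Random variables are functions
`Ω → ℝ`, measurable up to a null set; everything below respects almost sure equality. -/
def Lplus (P : Measure Ω) : Set (Ω → ℝ) :=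
  {X | MemLp X ⊤ P ∧ ∀ᵐ ω ∂P, 0 ≤ X ω}

/-- The distortion riskmetric `ρ_h(X)`. Only the values of `h` on `[0, 1]` matter. -/
def distortionRiskmetric (P : Measure Ω) (h : ℝ → ℝ) (X : Ω → ℝ) : ℝ :=
  (∫ x in Set.Ioi (0 : ℝ), h (P.real {ω | x ≤ X ω})) +
    ∫ x in Set.Iio (0 : ℝ), (h (P.real {ω | x ≤ X ω}) - h 1)

/-- The set `𝔸ₙ(X)` of feasible allocations of `X`, with components in `𝒳`. -/
def allocations (P : Measure Ω) (𝒳 : Set (Ω → ℝ)) (n : ℕ) (X : Ω → ℝ) :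
    Set (Fin n → Ω → ℝ) :=
  {Y | (∀ i, Y i ∈ 𝒳) ∧ ∀ᵐ ω ∂P, ∑ i, Y i ω = X ω}

/-- Two random variables are counter-monotonic. -/
def CounterMonotonic (P : Measure Ω) (X Y : Ω → ℝ) : Prop :=
  ∀ᵐ p ∂(P.prod P), (X p.1 - X p.2) * (Y p.1 - Y p.2) ≤ 0

/-- The set `𝔸ₙ⁻(X)` of (pairwise) counter-monotonic allocations of `X`. -/
def counterMonotonicAllocations (P : Measure Ω) (𝒳 : Set (Ω → ℝ)) (n : ℕ) (X : Ω → ℝ) :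
    Set (Fin n → Ω → ℝ) :=
  {Y | Y ∈ allocations P 𝒳 n X ∧ Pairwise fun i j => CounterMonotonic P (Y i) (Y j)}

/-- The infimum of the aggregate risk value `∑ ρᵢ(Yᵢ)` over a set of allocations, as an extended
real number. -/
def minTotalRisk {n : ℕ} (ρ : Fin n → (Ω → ℝ) → ℝ) (S : Set (Fin n → Ω → ℝ)) : EReal :=
  sInf ((fun Y => ((∑ i, ρ i (Y i) : ℝ) : EReal)) '' S)

/-- The (unconstrained) inf-convolution `□ ρᵢ (X)`. -/
def infConvolution (P : Measure Ω) (𝒳 : Set (Ω → ℝ)) {n : ℕ} (ρ : Fin n → (Ω → ℝ) → ℝ)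
    (X : Ω → ℝ) : EReal :=
  minTotalRisk ρ (allocations P 𝒳 n X)

/-- The counter-monotonic inf-convolution `⊟ ρᵢ (X)`. -/
def counterMonotonicInfConvolution (P : Measure Ω) (𝒳 : Set (Ω → ℝ)) {n : ℕ}
    (ρ : Fin n → (Ω → ℝ) → ℝ) (X : Ω → ℝ) : EReal :=
  minTotalRisk ρ (counterMonotonicAllocations P 𝒳 n X)

/-- `Y` is sum-optimal in `𝔸ₙ(X)`. -/
def IsSumOptimal (P : Measure Ω) (𝒳 : Set (Ω → ℝ)) {n : ℕ} (ρ : Fin n → (Ω → ℝ) → ℝ)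
    (X : Ω → ℝ) (Y : Fin n → Ω → ℝ) : Prop :=
  Y ∈ allocations P 𝒳 n X ∧ ((∑ i, ρ i (Y i) : ℝ) : EReal) = infConvolution P 𝒳 ρ X

/-- `Y` is an optimal allocation of `X` within the counter-monotonic allocations. -/
def IsCounterMonotonicOptimal (P : Measure Ω) (𝒳 : Set (Ω → ℝ)) {n : ℕ}
    (ρ : Fin n → (Ω → ℝ) → ℝ) (X : Ω → ℝ) (Y : Fin n → Ω → ℝ) : Prop :=
  Y ∈ counterMonotonicAllocations P 𝒳 n X ∧
    ((∑ i, ρ i (Y i) : ℝ) : EReal) = counterMonotonicInfConvolution P 𝒳 ρ X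

/-- `Πₙ`: the `n`-compositions of `Ω`. -/
def compositions (Ω : Type*) [MeasurableSpace Ω] (n : ℕ) : Set (Fin n → Set Ω) :=
  {A | (∀ i, MeasurableSet (A i)) ∧ Pairwise (fun i j => Disjoint (A i) (A j)) ∧
    ⋃ i, A i = Set.univ}

/-- The inf-convolution `□ hᵢ (x)` of functions on `[0, 1]`. -/
def funInfConvolution {n : ℕ} (h : Fin n → ℝ → ℝ) (x : ℝ) : ℝ :=
  sInf {s | ∃ y : Fin n → ℝ, (∀ i, y i ∈ Set.Icc (0 : ℝ) 1) ∧ ∑ i, y i = x ∧ s = ∑ i, h i (y i)}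

/-- The compositions `(A₁, …, Aₙ)` with `∑ hᵢ(P(Aᵢ)) = □ hᵢ (1)`. -/
def optimalCompositions (P : Measure Ω) {n : ℕ} (h : Fin n → ℝ → ℝ) : Set (Fin n → Set Ω) :=
  {A | A ∈ compositions Ω n ∧ ∑ i, h i (P.real (A i)) = funInfConvolution h 1}

end RiskSharing

end

noncomputable section

namespace RiskSharing

variable {Ω : Type*} [MeasurableSpace Ω] {P : Measure Ω}

/-! The components of an allocation of `1` lie in `[0, 1]`, so each risk is the integral over `(0,
1]` of a power of the survival function, whose mean is `E[Yᵢ]`. Jensen bounds it below by `E[Yᵢ] ^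
αᵢ`; the means sum to 1, so the total is at least `□ hᵢ (1)`. Strict convexity allows equality only
if every survival function is a.e. constant on `(0, 1]`, which makes the `Yᵢ` indicators of a
partition. Conversely, compactness gives a minimizing vector, atomlessness realizes it as
probabilities of a composition, and indicators of disjoint sets are counter-monotonic, so both
infima are attained there.

For monotonicity, a minimizer has positive coordinates and equal marginals `αᵢ xᵢ ^ (αᵢ - 1)`. With
`n ≥ 3` some coordinate is at most `1/3`, which forces the common marginal to be at most 1. In that
range, raising the exponent lowers the marginal, so a larger exponent cannot go with a smaller
coordinate. -/

/-! ### Atomless measures and compositions with prescribed probabilities. -/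

theorem Atomless.exists_measureReal_le_half [IsFiniteMeasure P] (hP : Atomless P) {A : Set Ω}
    (hA : MeasurableSet A) (hpos : 0 < P.real A) :
    ∃ B ⊆ A, MeasurableSet B ∧ 0 < P.real B ∧ P.real B ≤ P.real A / 2 := by
  obtain ⟨B, hBA, hB, hB0, hlt⟩ := hP A hA (by
    rw [Measure.real, ENNReal.toReal_pos_iff] at hpos; exact hpos.1)
  have hB0' : 0 < P.real B := ENNReal.toReal_pos hB0.ne' (measure_ne_top _ _)
  have hlt' : P.real B < P.real A :=
    (ENNReal.toReal_lt_toReal (measure_ne_top _ _) (measure_ne_top _ _)).2 hlt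
  have hdiff : P.real (A \ B) = P.real A - P.real B := measureReal_sdiff hBA hB
  rcases le_total (P.real B) (P.real A / 2) with h | h
  · exact ⟨B, hBA, hB, hB0', h⟩
  · exact ⟨A \ B, Set.sdiff_subset, hA.diff hB, by linarith, by linarith⟩

theorem Atomless.exists_measureReal_le [IsFiniteMeasure P] (hP : Atomless P) {A : Set Ω}
    (hA : MeasurableSet A) (hpos : 0 < P.real A) {ε : ℝ} (hε : 0 < ε) :
    ∃ B ⊆ A, MeasurableSet B ∧ 0 < P.real B ∧ P.real B ≤ ε := by
  have key : ∀ k : ℕ, ∃ B ⊆ A, MeasurableSet B ∧ 0 < P.real B ∧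
      P.real B ≤ P.real A * (1 / 2) ^ k := by
    intro k
    induction k with
    | zero => exact ⟨A, subset_rfl, hA, hpos, by simp⟩
    | succ k ih =>
      obtain ⟨B, hBA, hB, hB0, hBk⟩ := ih
      obtain ⟨C, hCB, hC, hC0, hCB'⟩ := hP.exists_measureReal_le_half hB hB0
      exact ⟨C, hCB.trans hBA, hC, hC0, by rw [pow_succ]; linarith⟩
  obtain ⟨k, hk⟩ := exists_pow_lt_of_lt_one (div_pos hε hpos) (by norm_num : (1 / 2 : ℝ) < 1)
  obtain ⟨B, hBA, hB, hB0, hBk⟩ := key k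
  refine ⟨B, hBA, hB, hB0, hBk.trans ?_⟩
  rw [lt_div_iff₀ hpos] at hk
  linarith

/-- Sierpiński's theorem: an atomless finite measure takes all intermediate values on the
measurable subsets of a measurable set. -/
theorem Atomless.exists_measureReal_eq [IsFiniteMeasure P] (hP : Atomless P) {A : Set Ω}
    (hA : MeasurableSet A) {c : ℝ} (hc0 : 0 ≤ c) (hcA : c ≤ P.real A) :
    ∃ B ⊆ A, MeasurableSet B ∧ P.real B = c := by
  let S := {B : Set Ω // B ⊆ A ∧ MeasurableSet B ∧ P.real B ≤ c}
  -- Greedy choice: `B'` achieves at least half of the best possible gain over `B` within `S`.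
  have step : ∀ B : S, ∃ B' : S, B.1 ⊆ B'.1 ∧
      ∀ D : S, B.1 ⊆ D.1 → P.real D.1 ≤ 2 * P.real B'.1 - P.real B.1 := by
    intro B
    by_cases hall : ∀ D : S, B.1 ⊆ D.1 → P.real D.1 ≤ P.real B.1
    · exact ⟨B, subset_rfl, fun D hD => by linarith [hall D hD]⟩
    push Not at hall
    obtain ⟨D₀, hD₀, hlt⟩ := hall
    let T : Set ℝ := {r | ∃ D : S, B.1 ⊆ D.1 ∧ r = P.real D.1}
    have hT : BddAbove T := ⟨c, by rintro _ ⟨D, -, rfl⟩; exact D.2.2.2⟩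
    have hs : P.real D₀.1 ≤ sSup T := le_csSup hT ⟨D₀, hD₀, rfl⟩
    obtain ⟨_, ⟨B', hB', rfl⟩, hlt'⟩ := exists_lt_of_lt_csSup
      (show T.Nonempty from ⟨_, D₀, hD₀, rfl⟩) (show (sSup T + P.real B.1) / 2 < sSup T by linarith)
    exact ⟨B', hB', fun D hD => by
      have : P.real D.1 ≤ sSup T := le_csSup hT ⟨D, hD, rfl⟩
      linarith⟩
  choose f hf hf' using step
  let B : ℕ → S := fun k => f^[k] ⟨∅, Set.empty_subset _, MeasurableSet.empty, by simpa using hc0⟩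
  have hBsucc : ∀ k, B (k + 1) = f (B k) := fun k => Function.iterate_succ_apply' _ _ _
  have hmono : Monotone fun k => (B k).1 :=
    monotone_nat_of_le_succ fun k => by rw [hBsucc]; exact hf _
  let U := ⋃ k, (B k).1
  have hU : MeasurableSet U := .iUnion fun k => (B k).2.2.1
  have hUA : U ⊆ A := Set.iUnion_subset fun k => (B k).2.1
  have hlim : Filter.Tendsto (fun k => P.real (B k).1) Filter.atTop (nhds (P.real U)) :=
    (ENNReal.tendsto_toReal (measure_ne_top _ _)).comp (tendsto_measure_iUnion_atTop hmono)
  have hUc : P.real U ≤ c := le_of_tendsto' hlim fun k => (B k).2.2.2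
  refine ⟨U, hUA, hU, hUc.antisymm ?_⟩
  by_contra! hlt
  have hdiff : P.real (A \ U) = P.real A - P.real U := measureReal_sdiff hUA hU
  obtain ⟨C, hCA, hC, hC0, hCle⟩ := hP.exists_measureReal_le (hA.diff hU)
    (by linarith) (sub_pos.2 hlt)
  have hUC : P.real (U ∪ C) = P.real U + P.real C :=
    measureReal_union (Set.disjoint_of_subset_right hCA Set.disjoint_sdiff_right) hC
  let D : S := ⟨U ∪ C, Set.union_subset hUA (hCA.trans Set.sdiff_subset), hU.union hC, by linarith⟩
  -- `U ∪ C` competes at every greedy step; the right side tends to `P.real U`, contradicting `0 <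
  -- P.real C`.
  have hD : ∀ k, P.real (U ∪ C) ≤ 2 * P.real (B (k + 1)).1 - P.real (B k).1 := fun k => by
    rw [hBsucc]
    exact hf' (B k) D ((Set.subset_iUnion (fun k => (B k).1) k).trans Set.subset_union_left)
  have := ge_of_tendsto' (((hlim.comp (Filter.tendsto_add_atTop_nat 1)).const_mul 2).sub hlim) hD
  linarith

theorem Atomless.exists_disjoint_measureReal_eq [IsFiniteMeasure P] (hP : Atomless P) {n : ℕ}
    (x : Fin n → ℝ) (hx : ∀ i, 0 ≤ x i) {A : Set Ω} (hA : MeasurableSet A)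
    (hxA : ∑ i, x i ≤ P.real A) :
    ∃ B : Fin n → Set Ω, (∀ i, B i ⊆ A) ∧ (∀ i, MeasurableSet (B i)) ∧
      Pairwise (fun i j => Disjoint (B i) (B j)) ∧ ∀ i, P.real (B i) = x i := by
  induction n generalizing A with
  | zero => exact ⟨fun i => i.elim0, fun i => i.elim0, fun i => i.elim0, fun i => i.elim0,
      fun i => i.elim0⟩
  | succ n ih =>
    rw [Fin.sum_univ_succ] at hxA
    have hnn : 0 ≤ ∑ i : Fin n, x i.succ := Finset.sum_nonneg fun i _ => hx _
    obtain ⟨C, hCA, hC, hCx⟩ := hP.exists_measureReal_eq hA (hx 0) (by linarith)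
    have hdiff : P.real (A \ C) = P.real A - P.real C := measureReal_sdiff hCA hC
    obtain ⟨B, hBA, hB, hBd, hBx⟩ := ih (fun i => x i.succ) (fun i => hx _) (hA.diff hC)
      (by linarith)
    have hCB : ∀ i, Disjoint C (B i) := fun i =>
      Set.disjoint_of_subset_right (hBA i) Set.disjoint_sdiff_right
    refine ⟨Fin.cons C B, ?_, ?_, ?_, ?_⟩
    · exact Fin.cases hCA fun i => (hBA i).trans Set.sdiff_subset
    · exact Fin.cases hC hB
    · intro i j
      refine Fin.cases ?_ (fun i => ?_) i <;> refine Fin.cases ?_ (fun j => ?_) j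
      · exact fun h => absurd rfl h
      · exact fun _ => hCB j
      · exact fun _ => (hCB i).symm
      · exact fun h => hBd fun hij => h (congrArg Fin.succ hij)
    · exact Fin.cases hCx hBx

/-- Sets that partition `Ω` up to a null set agree almost surely with a composition. -/
theorem exists_composition_ae_eq {n : ℕ} (hn : 1 ≤ n) {B : Fin n → Set Ω}
    (hB : ∀ i, MeasurableSet (B i)) (hae : ∀ᵐ ω ∂P, ∃! i, ω ∈ B i) :
    ∃ A ∈ compositions Ω n, ∀ i, A i =ᵐ[P] B i := by
  obtain ⟨G, hGm, hG, hGB⟩ := hae.exists_measurable_mem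
  have i₀ : Fin n := ⟨0, hn⟩
  -- The null set `Gᶜ`, where the partition may fail, is given wholly to one index.
  refine ⟨fun i => (B i ∩ G) ∪ if i = i₀ then Gᶜ else ∅, ⟨fun i => ?_, fun i j hij => ?_, ?_⟩,
    fun i => ?_⟩
  · refine ((hB i).inter hG).union ?_
    split_ifs
    exacts [hG.compl, .empty]
  · refine Set.disjoint_left.2 ?_
    rintro ω hi hj
    dsimp only at hi hj
    by_cases hω : ω ∈ G
    · have hBi : ω ∈ B i := by split_ifs at hi <;> simp_all
      have hBj : ω ∈ B j := by split_ifs at hj <;> simp_all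
      exact hij ((hGB ω hω).unique hBi hBj)
    · have hi' : i = i₀ := by by_contra h; simp_all
      have hj' : j = i₀ := by by_contra h; simp_all
      exact hij (hi'.trans hj'.symm)
  · refine Set.eq_univ_of_forall fun ω => Set.mem_iUnion.2 ?_
    by_cases hω : ω ∈ G
    · obtain ⟨i, hi, -⟩ := hGB ω hω
      exact ⟨i, Or.inl ⟨hi, hω⟩⟩
    · exact ⟨i₀, Or.inr (by simpa using hω)⟩
  · filter_upwards [hGm] with ω hω
    refine propext ⟨?_, fun h => Or.inl ⟨h, hω⟩⟩
    rintro (h | h)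
    · exact h.1
    · split_ifs at h
      · exact absurd hω h
      · exact h.elim

theorem Atomless.exists_composition_measureReal_eq [IsProbabilityMeasure P] (hP : Atomless P)
    {n : ℕ} (hn : 1 ≤ n) {x : Fin n → ℝ} (hx : ∀ i, 0 ≤ x i) (hsum : ∑ i, x i = 1) :
    ∃ A ∈ compositions Ω n, ∀ i, P.real (A i) = x i := by
  obtain ⟨B, -, hB, hBd, hBx⟩ := hP.exists_disjoint_measureReal_eq x hx MeasurableSet.univ
    (by simp [hsum])
  have hU : P.real (⋃ i, B i) = 1 := by
    rw [measureReal_iUnion_fintype hBd hB]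
    simp [hBx, hsum]
  have hUae : ∀ᵐ ω ∂P, ω ∈ ⋃ i, B i := by
    refine (mem_ae_iff_prob_eq_one (.iUnion hB)).2 ?_
    rwa [← ENNReal.toReal_eq_one_iff]
  obtain ⟨A, hA, hAB⟩ := exists_composition_ae_eq (P := P) hn hB (by
    filter_upwards [hUae] with ω hω
    obtain ⟨i, hi⟩ := Set.mem_iUnion.1 hω
    refine ⟨i, hi, fun j hj => ?_⟩
    by_contra hne
    exact Set.disjoint_left.1 (hBd hne) hj hi)
  exact ⟨A, hA, fun i => (measureReal_congr (hAB i)).trans (hBx i)⟩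

/-! ### Minimizing power sums on the simplex. -/

section PowerSums

variable {n : ℕ} {α : Fin n → ℝ} {h : Fin n → ℝ → ℝ}

theorem funInfConvolution_one_le (hh : ∀ i, ∀ x ∈ Set.Icc (0 : ℝ) 1, h i x = x ^ α i)
    {x : Fin n → ℝ} (hx : x ∈ stdSimplex ℝ (Fin n)) :
    funInfConvolution h 1 ≤ ∑ i, h i (x i) := by
  refine csInf_le ⟨0, ?_⟩ ⟨x, fun i => mem_Icc_of_mem_stdSimplex hx i, hx.2, rfl⟩
  rintro _ ⟨y, hy, -, rfl⟩
  refine Finset.sum_nonneg fun i _ => ?_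
  rw [hh i _ (hy i)]
  exact Real.rpow_nonneg (hy i).1 _

theorem exists_sum_eq_funInfConvolution_one (hn : 1 ≤ n) (hα : ∀ i, 1 < α i)
    (hh : ∀ i, ∀ x ∈ Set.Icc (0 : ℝ) 1, h i x = x ^ α i) :
    ∃ x ∈ stdSimplex ℝ (Fin n), ∑ i, h i (x i) = funInfConvolution h 1 := by
  have hcont : Continuous fun x : Fin n → ℝ => ∑ i, x i ^ α i :=
    continuous_finsetSum _ fun i _ =>
      (continuous_apply i).rpow_const fun _ => Or.inr (by linarith [hα i])
  have hval : ∀ y ∈ stdSimplex ℝ (Fin n), ∑ i, h i (y i) = ∑ i, y i ^ α i := fun y hy =>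
    Finset.sum_congr rfl fun i _ => hh i _ (mem_Icc_of_mem_stdSimplex hy i)
  obtain ⟨x, hx, hmin⟩ := (isCompact_stdSimplex ℝ (Fin n)).exists_isMinOn
    ⟨_, single_mem_stdSimplex ℝ (⟨0, hn⟩ : Fin n)⟩ hcont.continuousOn
  refine ⟨x, hx, le_antisymm ?_ (funInfConvolution_one_le hh hx)⟩
  refine le_csInf ⟨_, x, fun i => mem_Icc_of_mem_stdSimplex hx i, hx.2, rfl⟩ ?_
  rintro _ ⟨y, hy, hy1, rfl⟩
  have hy' : y ∈ stdSimplex ℝ (Fin n) := ⟨fun i => (hy i).1, hy1⟩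
  rw [hval x hx, hval y hy']
  exact hmin hy'

/-- First-order condition: at a minimizer, no mass can profitably be moved from `j` to `i`. -/
theorem marginal_le_of_isMinOn (hα : ∀ i, 1 < α i) {x : Fin n → ℝ}
    (hx : x ∈ stdSimplex ℝ (Fin n))
    (hmin : IsMinOn (fun y : Fin n → ℝ => ∑ i, y i ^ α i) (stdSimplex ℝ (Fin n)) x)
    {i j : Fin n} (hij : i ≠ j) (hj : 0 < x j) :
    α j * x j ^ (α j - 1) ≤ α i * x i ^ (α i - 1) := by
  let v : Fin n → ℝ := Pi.single i 1 - Pi.single j 1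
  let φ : ℝ → ℝ := fun t => ∑ k, (x k + t * v k) ^ α k
  have hv : ∑ k, v k = 0 := by simp [v]
  have hderiv : HasDerivAt φ (∑ k, v k * α k * x k ^ (α k - 1)) 0 := by
    refine HasDerivAt.fun_sum fun k _ => ?_
    have h1 : HasDerivAt (fun t : ℝ => x k + t * v k) (v k) 0 := by
      simpa using ((hasDerivAt_id (0 : ℝ)).mul_const (v k)).const_add (x k)
    simpa using h1.rpow_const (p := α k) (Or.inr (hα k).le)
  have hsum : ∑ k, v k * α k * x k ^ (α k - 1)
      = α i * x i ^ (α i - 1) - α j * x j ^ (α j - 1) := by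
    simp [v, sub_mul, Finset.sum_sub_distrib, Pi.single_apply]
  have hφ : ∀ t ∈ Set.Icc 0 (x j), φ 0 ≤ φ t := by
    intro t ht
    have hmem : (fun k => x k + t * v k) ∈ stdSimplex ℝ (Fin n) := by
      refine ⟨fun k => ?_, by rw [Finset.sum_add_distrib, ← Finset.mul_sum, hv, hx.2]; simp⟩
      by_cases hki : k = i
      · subst hki
        have := hx.1 k
        simp [v, hij]
        linarith [ht.1]
      · by_cases hkj : k = j
        · subst hkj
          simp [v, hki]
          linarith [ht.2]
        · simpa [v, hki, hkj] using hx.1 k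
    simpa [φ] using hmin hmem
  -- Only small `t ≥ 0` is known to stay in the simplex, so one-sided slopes are used.
  have hnonneg : 0 ≤ ∑ k, v k * α k * x k ^ (α k - 1) := by
    have hle : ∀ᶠ t in nhdsWithin (0 : ℝ) (Set.Ioi 0), 0 ≤ slope φ 0 t := by
      filter_upwards [Ioc_mem_nhdsGT hj] with t ht
      rw [slope_def_field]
      exact div_nonneg (sub_nonneg.2 (hφ t ⟨ht.1.le, ht.2⟩)) (by linarith [ht.1])
    have hlim := (hasDerivAt_iff_tendsto_slope.1 hderiv).mono_left
      (nhdsWithin_mono 0 fun t (ht : t ∈ Set.Ioi (0 : ℝ)) => ne_of_gt ht)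
    exact ge_of_tendsto hlim hle
  linarith

/-- For `0 < x` and `a ≤ b`, the map `t ↦ t * x ^ (t - 1)` decreases from `a` to `b` if its value
at `a` is at most `1`. -/
theorem mul_rpow_sub_one_le {a b x : ℝ} (ha : 1 < a) (hab : a ≤ b) (hx : 0 < x)
    (hle : a * x ^ (a - 1) ≤ 1) : b * x ^ (b - 1) ≤ a * x ^ (a - 1) := by
  have ha0 : 0 < a := by linarith
  have hlog : Real.log a + (a - 1) * Real.log x ≤ 0 := by
    rw [← Real.log_rpow hx, ← Real.log_mul ha0.ne' (Real.rpow_pos_of_pos hx _).ne']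
    exact Real.log_nonpos (by positivity) hle
  have hloga : 1 - a⁻¹ ≤ Real.log a := Real.one_sub_inv_le_log_of_pos ha0
  -- This says that `1 / t + log x`, the derivative of `log (t * x ^ (t - 1))`, is nonpositive at `t
  -- = a`, hence for all `t ≥ a`.
  have hlogx : a * Real.log x ≤ -1 := by
    have : (a - 1) * (a * Real.log x + 1) ≤ 0 := by
      have h1 : a * (1 - a⁻¹) = a - 1 := by field_simp
      nlinarith
    nlinarith
  have hba : b ≤ a * Real.exp ((b - a) / a) := by
    have := Real.add_one_le_exp ((b - a) / a)
    have h2 : a * ((b - a) / a + 1) = b := by field_simp; ring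
    nlinarith
  have hexp : Real.exp ((b - a) / a) ≤ x ^ (a - b) := by
    rw [Real.rpow_def_of_pos hx, Real.exp_le_exp, div_le_iff₀ ha0]
    nlinarith
  calc b * x ^ (b - 1) ≤ a * x ^ (a - b) * x ^ (b - 1) := by gcongr; exact hba.trans (by gcongr)
    _ = a * x ^ (a - 1) := by rw [mul_assoc, ← Real.rpow_add hx]; ring_nf

/-- Since `e < 3`, `a ≤ e ^ (a - 1) ≤ 3 ^ (a - 1)`; this is where three agents matter. -/
theorem mul_rpow_sub_one_le_one {a x : ℝ} (ha : 1 < a) (hx0 : 0 ≤ x) (hx : x ≤ 1 / 3) :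
    a * x ^ (a - 1) ≤ 1 := by
  have h3 : a ≤ 3 ^ (a - 1) := by
    have h := Real.add_one_le_exp (a - 1)
    have h' : Real.exp (a - 1) ≤ 3 ^ (a - 1) := by
      rw [← Real.exp_one_rpow]
      exact Real.rpow_le_rpow (Real.exp_pos _).le (by linarith [Real.exp_one_lt_d9]) (by linarith)
    linarith
  calc a * x ^ (a - 1) ≤ 3 ^ (a - 1) * (1 / 3) ^ (a - 1) := by gcongr
    _ = 1 := by rw [← Real.mul_rpow (by norm_num) (by norm_num)]; norm_num

theorem monotone_of_isMinOn (hn : 3 ≤ n) (hα : ∀ i, 1 < α i) (hmono : Monotone α)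
    {x : Fin n → ℝ} (hx : x ∈ stdSimplex ℝ (Fin n))
    (hmin : IsMinOn (fun y : Fin n → ℝ => ∑ i, y i ^ α i) (stdSimplex ℝ (Fin n)) x) :
    Monotone x := by
  have hpos : ∀ i, 0 < x i := by
    obtain ⟨j, hj⟩ : ∃ j, 0 < x j := by
      by_contra! hle
      linarith [hx.2, Finset.sum_nonpos fun i (_ : i ∈ Finset.univ) => hle i]
    intro i
    rcases eq_or_ne i j with rfl | hij
    · exact hj
    -- A zero coordinate has zero marginal cost, so moving mass to it would pay.
    refine (hx.1 i).lt_of_ne fun h0 => ?_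
    have hle := marginal_le_of_isMinOn hα hx hmin hij hj
    have hj' : 0 < α j * x j ^ (α j - 1) :=
      mul_pos (by linarith [hα j]) (Real.rpow_pos_of_pos hj _)
    rw [← h0, Real.zero_rpow (by linarith [hα i]), mul_zero] at hle
    linarith
  have heq : ∀ i j, α j * x j ^ (α j - 1) ≤ α i * x i ^ (α i - 1) := fun i j => by
    rcases eq_or_ne i j with rfl | hij
    · exact le_rfl
    · exact marginal_le_of_isMinOn hα hx hmin hij (hpos j)
  obtain ⟨k, hk⟩ : ∃ k, x k ≤ 1 / 3 := by
    by_contra! hlt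
    have hn' : (3 : ℝ) ≤ n := by exact_mod_cast hn
    have : ∑ _i : Fin n, (1 / 3 : ℝ) < ∑ i, x i :=
      Finset.sum_lt_sum_of_nonempty ⟨⟨0, by omega⟩, Finset.mem_univ _⟩ fun i _ => hlt i
    rw [hx.2] at this
    simp at this
    linarith
  intro i j hij
  by_contra! hlt
  have hi : α i * x i ^ (α i - 1) ≤ 1 :=
    (heq k i).trans (mul_rpow_sub_one_le_one (hα k) (hx.1 k) hk)
  have h1 := mul_rpow_sub_one_le (hα i) (hmono hij) (hpos i) hi
  have h2 : α j * x j ^ (α j - 1) < α j * x i ^ (α j - 1) :=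
    mul_lt_mul_of_pos_left (Real.rpow_lt_rpow (hx.1 j) hlt (by linarith [hα j]))
      (by linarith [hα j])
  linarith [heq j i]

end PowerSums

theorem minTotalRisk_eq_coe {Ω : Type*} {n : ℕ} {ρ : Fin n → (Ω → ℝ) → ℝ}
    {S : Set (Fin n → Ω → ℝ)} {m : ℝ}
    (hle : ∀ Y ∈ S, m ≤ ∑ i, ρ i (Y i)) (hex : ∃ Y ∈ S, ∑ i, ρ i (Y i) = m) :
    minTotalRisk ρ S = m := by
  refine IsLeast.csInf_eq ⟨?_, ?_⟩
  · obtain ⟨Y, hY, rfl⟩ := hex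
    exact ⟨Y, hY, rfl⟩
  · rintro _ ⟨Y, hY, rfl⟩
    exact EReal.coe_le_coe_iff.2 (hle Y hY)

theorem le_one_of_mem_allocations_one {n : ℕ} {Y : Fin n → Ω → ℝ}
    (hY : Y ∈ allocations P (Lplus P) n fun _ => 1) (i : Fin n) : ∀ᵐ ω ∂P, Y i ω ≤ 1 := by
  filter_upwards [hY.2, ae_all_iff.2 fun j => (hY.1 j).2] with ω hsum h0
  rw [← hsum]
  exact Finset.single_le_sum (fun j _ => h0 j) (Finset.mem_univ i)

/-! ### Power distortions of `[0, 1]`-valued random variables. -/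

variable [IsProbabilityMeasure P]

theorem distortionRiskmetric_eq_setIntegral_rpow {h : ℝ → ℝ} {a : ℝ} (ha : 0 < a)
    (hh : ∀ x ∈ Set.Icc (0 : ℝ) 1, h x = x ^ a) {Y : Ω → ℝ} (hY0 : ∀ᵐ ω ∂P, 0 ≤ Y ω)
    (hY1 : ∀ᵐ ω ∂P, Y ω ≤ 1) :
    distortionRiskmetric P h Y = ∫ x in Set.Ioc (0 : ℝ) 1, P.real {ω | x ≤ Y ω} ^ a := by
  have hneg : ∫ x in Set.Iio (0 : ℝ), (h (P.real {ω | x ≤ Y ω}) - h 1) = 0 := by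
    refine setIntegral_eq_zero_of_forall_eq_zero fun x (hx : x < 0) => ?_
    have : P.real {ω | x ≤ Y ω} = P.real Set.univ := measureReal_congr (by
      filter_upwards [hY0] with ω hω
      exact eq_true (hx.le.trans hω))
    rw [this, probReal_univ, sub_self]
  have hpos : ∫ x in Set.Ioi (0 : ℝ), h (P.real {ω | x ≤ Y ω}) =
      ∫ x in Set.Ioi (0 : ℝ), P.real {ω | x ≤ Y ω} ^ a :=
    setIntegral_congr_fun measurableSet_Ioi fun x _ => hh _ ⟨measureReal_nonneg, measureReal_le_one⟩
  rw [distortionRiskmetric, hneg, add_zero, hpos]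
  refine setIntegral_eq_of_subset_of_forall_sdiff_eq_zero measurableSet_Ioi
    Set.Ioc_subset_Ioi_self fun x hx => ?_
  have hx1 : 1 < x := by
    by_contra! hle
    exact hx.2 ⟨hx.1, hle⟩
  have : P.real {ω | x ≤ Y ω} = P.real ∅ := measureReal_congr (by
    filter_upwards [hY1] with ω hω
    exact eq_false (by show ¬ x ≤ Y ω; linarith))
  rw [this, measureReal_empty, Real.zero_rpow ha.ne']

theorem distortionRiskmetric_indicator {h : ℝ → ℝ} {a : ℝ} (ha : 0 < a)
    (hh : ∀ x ∈ Set.Icc (0 : ℝ) 1, h x = x ^ a) {Y : Ω → ℝ} {A : Set Ω}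
    (hY : Y =ᵐ[P] A.indicator fun _ => 1) :
    distortionRiskmetric P h Y = h (P.real A) := by
  have h0 : ∀ᵐ ω ∂P, 0 ≤ Y ω := by
    filter_upwards [hY] with ω hω
    rw [hω]
    exact Set.indicator_nonneg (fun _ _ => zero_le_one) ω
  have h1 : ∀ᵐ ω ∂P, Y ω ≤ 1 := by
    filter_upwards [hY] with ω hω
    rw [hω]
    exact Set.indicator_le_self' (fun _ _ => zero_le_one) ω
  rw [distortionRiskmetric_eq_setIntegral_rpow ha hh h0 h1,
    hh _ ⟨measureReal_nonneg, measureReal_le_one⟩,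
    setIntegral_congr_fun (g := fun _ => P.real A ^ a) measurableSet_Ioc fun x hx => ?_]
  · simp
  · have : P.real {ω | x ≤ Y ω} = P.real A := measureReal_congr (by
      filter_upwards [hY] with ω hω
      refine propext ?_
      show x ≤ Y ω ↔ ω ∈ A
      rw [hω]
      by_cases hA : ω ∈ A
      · simpa [hA] using hx.2
      · simpa [hA] using hx.1)
    simp only [this]

/-- If the survival function of `Y` is constant on `(0, 1]`, then `Y` takes no values in
`(0, 1)`. -/
theorem ae_notMem_Ioo_of_measureReal_le_eq {Y : Ω → ℝ} (hY : AEMeasurable Y P) {c : ℝ}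
    (hc : ∀ᵐ x ∂volume.restrict (Set.Ioc (0 : ℝ) 1), P.real {ω | x ≤ Y ω} = c) :
    ∀ᵐ ω ∂P, Y ω ∉ Set.Ioo (0 : ℝ) 1 := by
  have hex : ∀ s t : ℝ, 0 ≤ s → s < t → t ≤ 1 →
      ∃ x ∈ Set.Ioo s t, P.real {ω | x ≤ Y ω} = c := by
    intro s t hs hst ht
    have hc' : ∀ᵐ x ∂volume.restrict (Set.Ioo s t), P.real {ω | x ≤ Y ω} = c :=
      ae_restrict_of_ae_restrict_of_subset
        (show Set.Ioo s t ⊆ Set.Ioc 0 1 from fun x hx => ⟨hs.trans_lt hx.1, hx.2.le.trans ht⟩) hc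
    have : Filter.NeBot (ae (volume.restrict (Set.Ioo s t))) := by
      rw [ae_neBot, Ne, Measure.restrict_eq_zero, Real.volume_Ioo]
      simpa using hst
    obtain ⟨x, hx, hxc⟩ := ((ae_restrict_mem measurableSet_Ioo).and hc').exists
    exact ⟨x, hx, hxc⟩
  -- Closed intervals exhausting `(0, 1)`, each trapped between two levels with equal survival
  -- probability; the shift by 2 keeps the levels ordered.
  have key : ∀ k : ℕ, ∀ᵐ ω ∂P,
      ¬ (1 / ((k : ℝ) + 2) ≤ Y ω ∧ Y ω ≤ 1 - 1 / ((k : ℝ) + 2)) := by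
    intro k
    have hk : 0 < 1 / ((k : ℝ) + 2) := by positivity
    have hk' : 1 / ((k : ℝ) + 2) ≤ 1 / 2 :=
      one_div_le_one_div_of_le (by norm_num) (by linarith [(Nat.cast_nonneg k : (0 : ℝ) ≤ k)])
    obtain ⟨x, hx, hxc⟩ := hex 0 (1 / ((k : ℝ) + 2)) le_rfl hk (by linarith)
    obtain ⟨y, hy, hyc⟩ := hex (1 - 1 / ((k : ℝ) + 2)) 1 (by linarith) (by linarith) le_rfl
    have hsub : {ω | y ≤ Y ω} ⊆ {ω | x ≤ Y ω} := fun ω (hω : y ≤ Y ω) =>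
      (show x ≤ Y ω by linarith [hx.2, hy.1])
    have hle : P {ω | x ≤ Y ω} ≤ P {ω | y ≤ Y ω} :=
      ((ENNReal.toReal_eq_toReal_iff' (measure_ne_top _ _) (measure_ne_top _ _)).1
        (hxc.trans hyc.symm)).le
    filter_upwards [ae_eq_of_subset_of_measure_ge hsub hle
      (nullMeasurableSet_le aemeasurable_const hY) (measure_ne_top _ _)] with ω hω hmem
    have hyω : y ≤ Y ω := (iff_of_eq hω).2 (hx.2.le.trans hmem.1)
    linarith [hmem.2, hy.1]
  filter_upwards [ae_all_iff.2 key] with ω hω hmem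
  obtain ⟨k, hk⟩ := exists_nat_one_div_lt (lt_min hmem.1 (sub_pos.2 hmem.2))
  rw [lt_min_iff] at hk
  have : 1 / ((k : ℝ) + 2) ≤ 1 / ((k : ℝ) + 1) :=
    one_div_le_one_div_of_le (by positivity) (by linarith)
  exact hω k ⟨by linarith, by linarith⟩

/-- Jensen's inequality for the power distortion, with its equality case. -/
theorem rpow_integral_le_distortionRiskmetric {h : ℝ → ℝ} {a : ℝ} (ha : 1 < a)
    (hh : ∀ x ∈ Set.Icc (0 : ℝ) 1, h x = x ^ a) {Y : Ω → ℝ} (hY : AEMeasurable Y P)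
    (hY0 : ∀ᵐ ω ∂P, 0 ≤ Y ω) (hY1 : ∀ᵐ ω ∂P, Y ω ≤ 1) :
    (∫ ω, Y ω ∂P) ^ a ≤ distortionRiskmetric P h Y ∧
      (distortionRiskmetric P h Y ≤ (∫ ω, Y ω ∂P) ^ a → ∀ᵐ ω ∂P, Y ω = 0 ∨ Y ω = 1) := by
  let f : ℝ → ℝ := fun x => P.real {ω | x ≤ Y ω}
  have hanti : Antitone f := fun s t hst =>
    measureReal_mono fun ω (hω : t ≤ Y ω) => hst.trans hω
  have hmeas : Measurable f := hanti.measurable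
  have hf0 : ∀ x, 0 ≤ f x := fun x => measureReal_nonneg
  have hf1 : ∀ x, f x ≤ 1 := fun x => measureReal_le_one
  have : IsProbabilityMeasure (volume.restrict (Set.Ioc (0 : ℝ) 1)) := ⟨by simp⟩
  have hfi : Integrable f (volume.restrict (Set.Ioc (0 : ℝ) 1)) :=
    .of_bound hmeas.aestronglyMeasurable 1 (.of_forall fun x => by
      rw [Real.norm_of_nonneg (hf0 x)]; exact hf1 x)
  have hgi : Integrable ((fun x : ℝ => x ^ a) ∘ f) (volume.restrict (Set.Ioc (0 : ℝ) 1)) :=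
    .of_bound (hmeas.pow_const a).aestronglyMeasurable 1 (.of_forall fun x => by
      simp only [Function.comp]
      rw [Real.norm_of_nonneg (Real.rpow_nonneg (hf0 x) a)]
      exact Real.rpow_le_one (hf0 x) (hf1 x) (by linarith))
  have hYi : Integrable Y P := .of_bound hY.aestronglyMeasurable 1 (by
    filter_upwards [hY0, hY1] with ω h0 h1
    rwa [Real.norm_of_nonneg h0])
  -- Layer-cake formula; `(0, 1]` has length 1, so average and integral agree.
  have hmean : ⨍ x in Set.Ioc (0 : ℝ) 1, f x = ∫ ω, Y ω ∂P := by
    rw [average_eq_integral, hYi.integral_eq_integral_Ioc_meas_le hY0 hY1]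
  have hρ := distortionRiskmetric_eq_setIntegral_rpow (by linarith) hh hY0 hY1
  have hjensen := (strictConvexOn_rpow ha).ae_eq_const_or_map_average_lt
    (continuousOn_id.rpow_const fun x _ => Or.inr (by linarith)) isClosed_Ici
    (.of_forall hf0) hfi hgi
  rw [hmean, average_eq_integral, ← hρ] at hjensen
  rcases hjensen with hconst | hlt
  · refine ⟨?_, fun _ => ?_⟩
    · have hint : ∫ x in Set.Ioc (0 : ℝ) 1, f x ^ a =
          ∫ _x in Set.Ioc (0 : ℝ) 1, (∫ ω, Y ω ∂P) ^ a :=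
        integral_congr_ae (hconst.mono fun x hx => congrArg (· ^ a) hx)
      rw [hρ, hint]
      simp
    · filter_upwards [hY0, hY1, ae_notMem_Ioo_of_measureReal_le_eq hY hconst] with ω h0 h1 hω
      by_contra! hne
      exact hω ⟨h0.lt_of_ne hne.1.symm, h1.lt_of_ne hne.2⟩
  · exact ⟨hlt.le, fun hle => absurd hle (not_le.2 hlt)⟩

/-! ### Allocations of the constant 1. -/

variable {n : ℕ} {α : Fin n → ℝ} {h : Fin n → ℝ → ℝ}

theorem integral_mem_stdSimplex {Y : Fin n → Ω → ℝ}
    (hY : Y ∈ allocations P (Lplus P) n fun _ => 1) :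
    (fun i => ∫ ω, Y i ω ∂P) ∈ stdSimplex ℝ (Fin n) := by
  refine ⟨fun i => integral_nonneg_of_ae (hY.1 i).2, ?_⟩
  rw [← integral_finsetSum _ fun i _ => (hY.1 i).1.integrable le_top, integral_congr_ae hY.2]
  simp

theorem measureReal_mem_stdSimplex {A : Fin n → Set Ω} (hA : A ∈ compositions Ω n) :
    (fun i => P.real (A i)) ∈ stdSimplex ℝ (Fin n) :=
  ⟨fun i => measureReal_nonneg, by
    rw [← measureReal_iUnion_fintype hA.2.1 hA.1, hA.2.2, probReal_univ]⟩

theorem indicator_mem_counterMonotonicAllocations {A : Fin n → Set Ω}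
    (hA : A ∈ compositions Ω n) {Y : Fin n → Ω → ℝ}
    (hY : ∀ i, Y i =ᵐ[P] (A i).indicator fun _ => 1) :
    Y ∈ counterMonotonicAllocations P (Lplus P) n fun _ => 1 := by
  refine ⟨⟨fun i => ⟨?_, ?_⟩, ?_⟩, fun i j hij => ?_⟩
  · rw [memLp_congr_ae (hY i)]
    exact (memLp_const (1 : ℝ)).indicator (hA.1 i)
  · filter_upwards [hY i] with ω hω
    rw [hω]
    exact Set.indicator_nonneg (fun _ _ => zero_le_one) ω
  · filter_upwards [ae_all_iff.2 hY] with ω hω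
    obtain ⟨i, hi⟩ := Set.mem_iUnion.1 (hA.2.2.symm ▸ Set.mem_univ ω : ω ∈ ⋃ i, A i)
    rw [Finset.sum_eq_single i]
    · simp [hω, hi]
    · intro j _ hji
      rw [hω, Set.indicator_of_notMem (Set.disjoint_left.1 (hA.2.1 hji.symm) hi)]
    · simp
  · have hfst : ∀ k, ∀ᵐ p ∂P.prod P, Y k p.1 = (A k).indicator (fun _ => 1) p.1 := fun k =>
      Measure.quasiMeasurePreserving_fst.ae (hY k)
    have hsnd : ∀ k, ∀ᵐ p ∂P.prod P, Y k p.2 = (A k).indicator (fun _ => 1) p.2 := fun k =>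
      Measure.quasiMeasurePreserving_snd.ae (hY k)
    filter_upwards [hfst i, hfst j, hsnd i, hsnd j] with p h1 h2 h3 h4
    have hd : ∀ ω, ω ∈ A i → ω ∉ A j := fun ω h => Set.disjoint_left.1 (hA.2.1 hij) h
    have hd1 := hd p.1
    have hd2 := hd p.2
    rw [h1, h2, h3, h4]
    by_cases hi1 : p.1 ∈ A i <;> by_cases hi2 : p.2 ∈ A i <;> by_cases hj1 : p.1 ∈ A j <;>
      by_cases hj2 : p.2 ∈ A j <;> simp_all

theorem sum_distortionRiskmetric_indicator (hα : ∀ i, 1 < α i)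
    (hh : ∀ i, ∀ x ∈ Set.Icc (0 : ℝ) 1, h i x = x ^ α i) {A : Fin n → Set Ω}
    (hA : A ∈ optimalCompositions P h) {Y : Fin n → Ω → ℝ}
    (hY : ∀ i, Y i =ᵐ[P] (A i).indicator fun _ => 1) :
    ∑ i, distortionRiskmetric P (h i) (Y i) = funInfConvolution h 1 := by
  rw [← hA.2]
  exact Finset.sum_congr rfl fun i _ =>
    distortionRiskmetric_indicator (by linarith [hα i]) (hh i) (hY i)

theorem funInfConvolution_le_sum_distortionRiskmetric (hα : ∀ i, 1 < α i)
    (hh : ∀ i, ∀ x ∈ Set.Icc (0 : ℝ) 1, h i x = x ^ α i) {Y : Fin n → Ω → ℝ}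
    (hY : Y ∈ allocations P (Lplus P) n fun _ => 1) :
    funInfConvolution h 1 ≤ ∑ i, distortionRiskmetric P (h i) (Y i) := by
  have hmem := integral_mem_stdSimplex hY
  refine (funInfConvolution_one_le hh hmem).trans (Finset.sum_le_sum fun i _ => ?_)
  rw [hh i _ (mem_Icc_of_mem_stdSimplex hmem i)]
  exact (rpow_integral_le_distortionRiskmetric (hα i) (hh i)
    (hY.1 i).1.aestronglyMeasurable.aemeasurable (hY.1 i).2 (le_one_of_mem_allocations_one hY i)).1

/-- Allocations of `1` attaining the minimal total risk are indicators of a composition. -/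
theorem exists_optimalComposition_of_sum_eq (hn : 1 ≤ n) (hα : ∀ i, 1 < α i)
    (hh : ∀ i, ∀ x ∈ Set.Icc (0 : ℝ) 1, h i x = x ^ α i) {Y : Fin n → Ω → ℝ}
    (hY : Y ∈ allocations P (Lplus P) n fun _ => 1)
    (hsum : ∑ i, distortionRiskmetric P (h i) (Y i) = funInfConvolution h 1) :
    ∃ A ∈ optimalCompositions P h, ∀ i, Y i =ᵐ[P] (A i).indicator fun _ => 1 := by
  have hYm : ∀ i, AEMeasurable (Y i) P := fun i => (hY.1 i).1.aestronglyMeasurable.aemeasurable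
  have hmem := integral_mem_stdSimplex hY
  have hjensen := fun i => rpow_integral_le_distortionRiskmetric (hα i) (hh i) (hYm i) (hY.1 i).2
    (le_one_of_mem_allocations_one hY i)
  -- Combined with Jensen in each term, this forces equality in every term.
  have hle : ∑ i, distortionRiskmetric P (h i) (Y i) ≤ ∑ i, (∫ ω, Y i ω ∂P) ^ α i := by
    rw [hsum]
    refine (funInfConvolution_one_le hh hmem).trans_eq (Finset.sum_congr rfl fun i _ => ?_)
    exact hh i _ (mem_Icc_of_mem_stdSimplex hmem i)
  have heq := (Finset.sum_eq_sum_iff_of_le fun i _ => (hjensen i).1).1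
    (le_antisymm (Finset.sum_le_sum fun i _ => (hjensen i).1) hle)
  have h01 : ∀ᵐ ω ∂P, ∀ i, Y i ω = 0 ∨ Y i ω = 1 :=
    ae_all_iff.2 fun i => (hjensen i).2 (heq i (Finset.mem_univ i)).ge
  have hmk : ∀ᵐ ω ∂P, ∀ i, Y i ω = (hYm i).mk (Y i) ω := ae_all_iff.2 fun i => (hYm i).ae_eq_mk
  obtain ⟨A, hA, hAB⟩ := exists_composition_ae_eq (P := P) hn
    (B := fun i => {ω | (hYm i).mk (Y i) ω = 1})
    (fun i => (hYm i).measurable_mk (measurableSet_singleton 1)) (by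
      filter_upwards [h01, hmk, hY.2] with ω h01 hmk hsum
      simp only [← hmk]
      obtain ⟨i, hi⟩ : ∃ i, Y i ω = 1 := by
        by_contra! hne
        simp [fun i => (h01 i).resolve_right (hne i)] at hsum
      refine ⟨i, hi, fun j hj => ?_⟩
      by_contra hji
      -- Two components equal to 1 would make the sum at least 2.
      have := Finset.add_le_sum (s := Finset.univ) (f := fun k => Y k ω)
        (fun k _ => by rcases h01 k with h | h <;> simp [h]) (Finset.mem_univ j)
        (Finset.mem_univ i) hji
      rw [hsum] at this
      simp only [hi, hj] at this
      norm_num at this)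
  have hYA : ∀ i, Y i =ᵐ[P] (A i).indicator fun _ => 1 := fun i => by
    filter_upwards [h01, hmk, hAB i] with ω h01 hmk hAB
    have hiff : ω ∈ A i ↔ Y i ω = 1 := by
      rw [hmk i]
      exact iff_of_eq hAB
    by_cases hω : ω ∈ A i
    · rw [Set.indicator_of_mem hω, hiff.1 hω]
    · rw [Set.indicator_of_notMem hω, (h01 i).resolve_right fun h => hω (hiff.2 h)]
  refine ⟨A, ⟨hA, ?_⟩, hYA⟩
  rw [← hsum]
  exact Finset.sum_congr rfl fun i _ =>
    (distortionRiskmetric_indicator (by linarith [hα i]) (hh i) (hYA i)).symm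

end RiskSharing
end

/-! ### The main theorem. -/

open RiskSharing in
theorem proposition3 {Ω : Type*} [MeasurableSpace Ω] (P : Measure Ω) [IsProbabilityMeasure P]
    (hP : Atomless P) (n : ℕ) (hn : 1 ≤ n) (α : Fin n → ℝ) (hα : ∀ i, 1 < α i)
    (h : Fin n → ℝ → ℝ) (hh : ∀ i, ∀ x ∈ Set.Icc (0 : ℝ) 1, h i x = x ^ α i)
    (ρ : Fin n → (Ω → ℝ) → ℝ) (hρ : ∀ i, ρ i = distortionRiskmetric P (h i))
    (X : Ω → ℝ) (hX : X = fun _ => 1) :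
    (infConvolution P (Lplus P) ρ X = counterMonotonicInfConvolution P (Lplus P) ρ X ∧
      counterMonotonicInfConvolution P (Lplus P) ρ X = (funInfConvolution h 1 : EReal) ∧
      (optimalCompositions P h).Nonempty ∧
      (∀ Y : Fin n → Ω → ℝ, IsSumOptimal P (Lplus P) ρ X Y ↔
        ∃ A ∈ optimalCompositions P h, ∀ i, Y i =ᵐ[P] (A i).indicator (fun _ => 1)) ∧
      (∀ Y : Fin n → Ω → ℝ, IsCounterMonotonicOptimal P (Lplus P) ρ X Y ↔
        ∃ A ∈ optimalCompositions P h, ∀ i, Y i =ᵐ[P] (A i).indicator (fun _ => 1))) ∧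
    (3 ≤ n → Monotone α → ∀ A ∈ optimalCompositions P h,
      Monotone fun i => P.real (A i)) := by
  obtain rfl : ρ = fun i => distortionRiskmetric P (h i) := funext hρ
  subst hX
  obtain ⟨x, hx, hxmin⟩ := exists_sum_eq_funInfConvolution_one hn hα hh
  obtain ⟨A, hA, hAx⟩ := hP.exists_composition_measureReal_eq hn hx.1 hx.2
  have hAopt : A ∈ optimalCompositions P h := ⟨hA, by simpa only [hAx] using hxmin⟩
  -- This single allocation attains both infima.
  have hAcm := indicator_mem_counterMonotonicAllocations (P := P) hA fun i => Filter.EventuallyEq.rfl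
  have hAsum := sum_distortionRiskmetric_indicator (P := P) hα hh hAopt
    fun i => Filter.EventuallyEq.rfl
  have hinf : infConvolution P (Lplus P) (fun i => distortionRiskmetric P (h i)) (fun _ => 1)
      = (funInfConvolution h 1 : EReal) :=
    minTotalRisk_eq_coe (fun Y hY => funInfConvolution_le_sum_distortionRiskmetric hα hh hY)
      ⟨_, hAcm.1, hAsum⟩
  have hcm : counterMonotonicInfConvolution P (Lplus P) (fun i => distortionRiskmetric P (h i))
      (fun _ => 1) = (funInfConvolution h 1 : EReal) :=
    minTotalRisk_eq_coe (fun Y hY => funInfConvolution_le_sum_distortionRiskmetric hα hh hY.1)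
      ⟨_, hAcm, hAsum⟩
  refine ⟨⟨hinf.trans hcm.symm, hcm, ⟨A, hAopt⟩, fun Y => ⟨?_, ?_⟩, fun Y => ⟨?_, ?_⟩⟩, ?_⟩
  · rintro ⟨hY, hsum⟩
    rw [hinf, EReal.coe_eq_coe_iff] at hsum
    exact exists_optimalComposition_of_sum_eq hn hα hh hY hsum
  · rintro ⟨B, hB, hYB⟩
    refine ⟨(indicator_mem_counterMonotonicAllocations hB.1 hYB).1, ?_⟩
    rw [hinf, sum_distortionRiskmetric_indicator hα hh hB hYB]
  · rintro ⟨hY, hsum⟩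
    rw [hcm, EReal.coe_eq_coe_iff] at hsum
    exact exists_optimalComposition_of_sum_eq hn hα hh hY.1 hsum
  · rintro ⟨B, hB, hYB⟩
    refine ⟨indicator_mem_counterMonotonicAllocations hB.1 hYB, ?_⟩
    rw [hcm, sum_distortionRiskmetric_indicator hα hh hB hYB]
  · intro hn3 hmono B hB
    have hval : ∀ y ∈ stdSimplex ℝ (Fin n), ∑ i, h i (y i) = ∑ i, y i ^ α i := fun y hy =>
      Finset.sum_congr rfl fun i _ => hh i _ (mem_Icc_of_mem_stdSimplex hy i)
    have hBmem := measureReal_mem_stdSimplex (P := P) hB.1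
    refine monotone_of_isMinOn hn3 hα hmono hBmem fun y hy => ?_
    show ∑ i, P.real (B i) ^ α i ≤ ∑ i, y i ^ α i
    rw [← hval _ hBmem, ← hval y hy, hB.2]
    exact funInfConvolution_one_le hh hy
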